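/- Let $\mathcal H$ be an infinite-dimensional separable complex Hilbert space and let $T$ be a bounded linear operator on $\mathcal H$. Then there is a closed infinite-dimensional subspace $Y\subseteq\mathcal H$ whose orthogonal complement $Y^\perp$ is also infinite-dimensional, such that, with $P$ the orthogonal projection onto $Y$, the operator $(I-P)TP$ has rank at most one, and has rank exactly one unless $T$ is a scalar multiple of the identity. Equivalently, relative to the decomposition $\mathcal H=Y\oplus Y^\perp$, $T$ has the form $$T=\begin{bmatrix} * & * \\ F & * \end{bmatrix},$$ where $F:Y\to Y^\perp$ has rank at most one, and rank exactly one unless $T$ is a scalar multiple of the identity. -/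

import Mathlib

/-- The operator `(I - P) T P` on `H`, where `P` is the orthogonal projection onto `Y`. -/
noncomputable def offDiagonalPart {H : Type*} [NormedAddCommGroup H] [InnerProductSpace ℂ H]
    (T : H →L[ℂ] H) (Y : Submodule ℂ H) [Y.HasOrthogonalProjection] : H →L[ℂ] H :=
  (1 - Y.starProjection) * T * Y.starProjection

/-- The lower-left corner `Y → Yᗮ` of the operator matrix of `T` relative to `H = Y ⊕ Yᗮ`:
restrict `T` to `Y` and project orthogonally onto `Yᗮ`. -/
noncomputable def lowerLeftCorner {H : Type*} [NormedAddCommGroup H] [InnerProductSpace ℂ H]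
    (T : H →L[ℂ] H) (Y : Submodule ℂ H) [Y.HasOrthogonalProjection] : Y →L[ℂ] Yᗮ :=
  Yᗮ.orthogonalProjectionOnto ∘L T ∘L Y.subtypeL

open Filter Topology InnerProductSpace

/-! A half-space on which `T` is invariant modulo one vector gives corners of rank at most one, and
rank exactly one if it is not invariant. So two existence results suffice:
`hasAlmostInvariantHalfSpace` and, for nonscalar `T`, `hasStrictlyAlmostInvariantHalfSpace`.

For the first, let `μ` be a boundary point of the spectrum that is not an eigenvalue. Resolvent
vectors of a suitable `e` blow up along points tending to `μ`; normalised, they are weakly null, and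
`T` maps each into its own line plus the line of `e`. An almost orthonormal subsequence then has a
subset spanning a half-space. So if `T` is a counterexample, every boundary point is an eigenvalue,
and its conjugate is one of the adjoint. Infinitely many would give biorthogonal eigenvectors and an
invariant half-space; hence the spectrum is finite, and generalised eigenspaces turn out
finite-dimensional. Their span `V` is finite-dimensional, but the compression of `T` to `Vᗮ` has an
eigenvector, which enlarges `V` to a finite-dimensional invariant subspace not contained in `V`: a
contradiction.

For the second, if every half-space invariant up to one dimension is invariant, then `T` is scalar
modulo each invariant half-space. Two invariant half-spaces with zero intersection force `T` to be
scalar. -/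

/-- A closed subspace of infinite dimension and infinite codimension. -/
structure IsHalfSpace {H : Type*} [NormedAddCommGroup H] [InnerProductSpace ℂ H]
    (Y : Submodule ℂ H) : Prop where
  isClosed : IsClosed (Y : Set H)
  not_finiteDimensional : ¬ FiniteDimensional ℂ Y
  not_finiteDimensional_orthogonal : ¬ FiniteDimensional ℂ Yᗮ

/-- `Y` is invariant under `T` up to the line spanned by `e`. -/
def IsInvariantModulo {H : Type*} [NormedAddCommGroup H] [InnerProductSpace ℂ H]
    (T : H →L[ℂ] H) (Y : Submodule ℂ H) (e : H) : Prop :=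
  ∀ y ∈ Y, ∃ c : ℂ, T y - c • e ∈ Y

/-- `T` has a half-space that is invariant up to one dimension. -/
def HasAlmostInvariantHalfSpace {H : Type*} [NormedAddCommGroup H] [InnerProductSpace ℂ H]
    (T : H →L[ℂ] H) : Prop :=
  ∃ (Y : Submodule ℂ H) (e : H), IsHalfSpace Y ∧ IsInvariantModulo T Y e

/-! ### Half-spaces, adjoints and restrictions -/

section Basic

variable {H : Type*} [NormedAddCommGroup H] [InnerProductSpace ℂ H]

theorem not_finiteDimensional_of_linearIndependent {V : Type*} [AddCommGroup V] [Module ℂ V]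
    {Y : Submodule ℂ V} {x : ℕ → V} (hx : LinearIndependent ℂ x) (hY : ∀ n, x n ∈ Y) :
    ¬ FiniteDimensional ℂ Y := by
  intro h
  have : LinearIndependent ℂ (fun n => (⟨x n, hY n⟩ : Y)) :=
    LinearIndependent.of_comp Y.subtype hx
  have := this.finite
  exact not_finite ℕ

theorem not_finiteDimensional_of_le {V : Type*} [AddCommGroup V] [Module ℂ V]
    {X Y : Submodule ℂ V} (h : ¬ FiniteDimensional ℂ X) (hXY : X ≤ Y) :
    ¬ FiniteDimensional ℂ Y := fun _ => h (Submodule.finiteDimensional_of_le hXY)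

theorem mem_orthogonal_topologicalClosure_span {s : Set H} {y : H}
    (h : ∀ x ∈ s, ⟪x, y⟫_ℂ = 0) : y ∈ (Submodule.span ℂ s).topologicalClosureᗮ := by
  rw [Submodule.orthogonal_closure]
  rw [Submodule.mem_orthogonal]
  intro u hu
  induction hu using Submodule.span_induction with
  | mem x hx => exact h x hx
  | zero => simp
  | add x y _ _ hx hy => rw [inner_add_left, hx, hy, add_zero]
  | smul a x _ hx => rw [inner_smul_left, hx, mul_zero]

theorem IsHalfSpace.of_orthogonal_sequences {x y : ℕ → H} (hx : LinearIndependent ℂ x)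
    (hy : LinearIndependent ℂ y) (hxy : ∀ m n, ⟪x m, y n⟫_ℂ = 0) :
    IsHalfSpace (Submodule.span ℂ (Set.range x)).topologicalClosure where
  isClosed := Submodule.isClosed_topologicalClosure _
  not_finiteDimensional := not_finiteDimensional_of_linearIndependent hx fun n =>
    Submodule.le_topologicalClosure _ (Submodule.subset_span ⟨n, rfl⟩)
  not_finiteDimensional_orthogonal := not_finiteDimensional_of_linearIndependent hy fun n => by
    apply mem_orthogonal_topologicalClosure_span
    rintro _ ⟨m, rfl⟩
    exact hxy m n

theorem exists_isHalfSpace [CompleteSpace H] (hH : ¬ FiniteDimensional ℂ H) :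
    ∃ Y : Submodule ℂ H, IsHalfSpace Y := by
  obtain ⟨w, b, hb⟩ := exists_hilbertBasis ℂ H
  have hw : Infinite w := by
    by_contra hfin
    rw [not_infinite_iff_finite] at hfin
    apply hH
    have hd := b.dense_span
    have : FiniteDimensional ℂ (Submodule.span ℂ (Set.range b)) :=
      FiniteDimensional.span_of_finite ℂ (Set.finite_range b)
    have hcl := (Submodule.span ℂ (Set.range b)).closed_of_finiteDimensional
    rw [hcl.submodule_topologicalClosure_eq] at hd
    rw [hd] at this
    exact Module.finite_def.2 (Module.Finite.iff_fg.1 this)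
  have hon := b.orthonormal.comp _ (Infinite.natEmbedding w).injective
  have heven : Function.Injective (fun n : ℕ => 2 * n) := fun a b h => by simpa using h
  have hodd : Function.Injective (fun n : ℕ => 2 * n + 1) := fun a b h => by simpa using h
  exact ⟨_, IsHalfSpace.of_orthogonal_sequences (hon.comp _ heven).linearIndependent
    (hon.comp _ hodd).linearIndependent fun m n => 
    hon.inner_eq_zero (show 2 * m ≠ 2 * n + 1 by omega)⟩

theorem IsInvariantModulo.topologicalClosure_span {T : H →L[ℂ] H} {s : Set H} {e : H}
    (h : ∀ x ∈ s, ∃ c : ℂ, T x - c • e ∈ Submodule.span ℂ s) :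
    IsInvariantModulo T (Submodule.span ℂ s).topologicalClosure e := by
  set Y := (Submodule.span ℂ s).topologicalClosure
  -- Adding a finite-dimensional space keeps `Y` closed, so the inclusion passes from the span to
  -- its closure.
  have hcl : IsClosed ((Y ⊔ Submodule.span ℂ {e} : Submodule ℂ H) : Set H) :=
    Submodule.isClosed_sup_finiteDimensional _ _ (Submodule.isClosed_topologicalClosure _)
  have hsub : Y ≤ (Y ⊔ Submodule.span ℂ {e}).comap (T : H →ₗ[ℂ] H) := by
    apply Submodule.topologicalClosure_minimal
    · rw [Submodule.span_le]
      intro x hx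
      obtain ⟨c, hc⟩ := h x hx
      refine Submodule.mem_sup.2 ⟨_, Submodule.le_topologicalClosure _ hc, c • e,
        Submodule.smul_mem _ _ (Submodule.mem_span_singleton_self e), by simp⟩
    · exact hcl.preimage T.continuous
  intro y hy
  obtain ⟨z, hz, w, hw, hzw⟩ := Submodule.mem_sup.1 (hsub hy)
  obtain ⟨c, rfl⟩ := Submodule.mem_span_singleton.1 hw
  refine ⟨c, ?_⟩
  have : T y = z + c • e := hzw.symm
  rw [this]
  simpa using hz

theorem IsHalfSpace.orthogonal [CompleteSpace H] {Y : Submodule ℂ H} (h : IsHalfSpace Y) :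
    IsHalfSpace Yᗮ where
  isClosed := Y.isClosed_orthogonal
  not_finiteDimensional := h.not_finiteDimensional_orthogonal
  not_finiteDimensional_orthogonal := by
    have := h.isClosed.completeSpace_coe
    rw [Submodule.orthogonal_orthogonal]
    exact h.not_finiteDimensional

theorem IsInvariantModulo.exists_mem_orthogonal [CompleteSpace H] {T : H →L[ℂ] H}
    {Y : Submodule ℂ H} {e : H} (hY : IsClosed (Y : Set H)) (h : IsInvariantModulo T Y e) :
    ∃ f ∈ Yᗮ, IsInvariantModulo T Y f := by
  have := hY.completeSpace_coe
  refine ⟨e - Y.starProjection e, Y.sub_starProjection_mem_orthogonal e, fun y hy => ?_⟩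
  obtain ⟨c, hc⟩ := h y hy
  refine ⟨c, ?_⟩
  have : T y - c • (e - Y.starProjection e) = (T y - c • e) + c • Y.starProjection e := by
    module
  rw [this]
  exact Y.add_mem hc (Y.smul_mem c (Y.starProjection_apply_mem e))

theorem IsInvariantModulo.adjoint [CompleteSpace H] {T : H →L[ℂ] H} {Y : Submodule ℂ H} {e : H}
    (hY : IsClosed (Y : Set H)) (h : IsInvariantModulo T Y e) :
    ∃ f, IsInvariantModulo (ContinuousLinearMap.adjoint T) Yᗮ f := by
  obtain ⟨f, hf, hTf⟩ := h.exists_mem_orthogonal hY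
  -- The coefficient makes `z - c • f` orthogonal to `f` as well as to `Y`, hence to `T Y`. If `f =
  -- 0`, the quotient is `0` and `Y` is invariant.
  refine ⟨ContinuousLinearMap.adjoint T f, fun z _ => ⟨⟪f, z⟫_ℂ / ⟪f, f⟫_ℂ, ?_⟩⟩
  rw [Submodule.mem_orthogonal]
  intro y hy
  obtain ⟨c, hc⟩ := hTf y hy
  have h1 : ⟪T y, f⟫_ℂ = (starRingEnd ℂ) c * ⟪f, f⟫_ℂ := by
    have := Submodule.inner_right_of_mem_orthogonal hc hf
    rwa [inner_sub_left, inner_smul_left, sub_eq_zero] at this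
  have h2 : ⟪T y, z⟫_ℂ = (starRingEnd ℂ) c * ⟪f, z⟫_ℂ := by
    have := Submodule.inner_right_of_mem_orthogonal hc ‹z ∈ Yᗮ›
    rwa [inner_sub_left, inner_smul_left, sub_eq_zero] at this
  rw [inner_sub_right, inner_smul_right, ContinuousLinearMap.adjoint_inner_right,
    ContinuousLinearMap.adjoint_inner_right, h1, h2]
  by_cases hf0 : f = 0
  · simp [hf0]
  · have : ⟪f, f⟫_ℂ ≠ 0 := inner_self_ne_zero.2 hf0
    field_simp
    ring

theorem HasAlmostInvariantHalfSpace.adjoint [CompleteSpace H] {T : H →L[ℂ] H}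
    (h : HasAlmostInvariantHalfSpace T) :
    HasAlmostInvariantHalfSpace (ContinuousLinearMap.adjoint T) := by
  obtain ⟨Y, e, hY, hT⟩ := h
  obtain ⟨f, hf⟩ := hT.adjoint hY.isClosed
  exact ⟨Yᗮ, f, hY.orthogonal, hf⟩

theorem IsHalfSpace.map_subtype {W : Submodule ℂ H} (hW : IsClosed (W : Set H))
    {Z : Submodule ℂ W} (hZ : IsHalfSpace Z) : IsHalfSpace (Z.map W.subtype) := by
  have key : ∀ X : Submodule ℂ W, ¬ FiniteDimensional ℂ X →
      ¬ FiniteDimensional ℂ (X.map W.subtype) := fun X hX h =>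
    hX (Module.Finite.equiv (Submodule.equivMapOfInjective _ W.injective_subtype X).symm)
  refine ⟨?_, key _ hZ.not_finiteDimensional, ?_⟩
  · exact hW.isClosedEmbedding_subtypeVal.isClosedMap _ hZ.isClosed
  · refine not_finiteDimensional_of_le (key _ hZ.not_finiteDimensional_orthogonal) ?_
    rintro _ ⟨x, hx, rfl⟩
    rw [Submodule.mem_orthogonal]
    rintro _ ⟨z, hz, rfl⟩
    exact hx z hz

/-- Its contrapositive is what matters: a counterexample restricts to a counterexample on every
closed invariant subspace. -/
theorem HasAlmostInvariantHalfSpace.of_restrict {T : H →L[ℂ] H} {W : Submodule ℂ H}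
    (hW : IsClosed (W : Set H)) (hT : ∀ x ∈ W, T x ∈ W)
    (h : HasAlmostInvariantHalfSpace (T.restrict hT)) : HasAlmostInvariantHalfSpace T := by
  obtain ⟨Z, e, hZ, hi⟩ := h
  refine ⟨Z.map W.subtype, e, hZ.map_subtype hW, ?_⟩
  rintro _ ⟨z, hz, rfl⟩
  obtain ⟨c, hc⟩ := hi z hz
  exact ⟨c, _, hc, by simp⟩

theorem HasAlmostInvariantHalfSpace.of_ker [CompleteSpace H] {T : H →L[ℂ] H} {μ : ℂ}
    (h : ¬ FiniteDimensional ℂ (Module.End.eigenspace (T : H →ₗ[ℂ] H) μ)) :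
    HasAlmostInvariantHalfSpace T := by
  set W := Module.End.eigenspace (T : H →ₗ[ℂ] H) μ
  have hmem : ∀ x, x ∈ W ↔ T x = μ • x := fun x => Module.End.mem_eigenspace_iff
  have hW : IsClosed (W : Set H) := by
    have : (W : Set H) = {x | T x = μ • x} := Set.ext hmem
    rw [this]
    exact isClosed_eq T.continuous (continuous_const_smul μ)
  have := hW.completeSpace_coe
  have hT : ∀ x ∈ W, T x ∈ W := fun x hx => by
    rw [(hmem x).1 hx]
    exact W.smul_mem μ hx
  obtain ⟨Z, hZ⟩ := exists_isHalfSpace h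
  refine .of_restrict hW hT ⟨Z, 0, hZ, fun z hz => ⟨0, ?_⟩⟩
  have : T.restrict hT z = μ • z := Subtype.ext ((hmem z).1 z.2)
  simpa [this] using Z.smul_mem μ hz

end Basic

/-! ### Boundary points of the spectrum that are not eigenvalues -/

section AlmostOrthonormal

variable {H : Type*} [NormedAddCommGroup H] [InnerProductSpace ℂ H]

/-- A sequence whose Gram matrix differs from the identity by at most `2⁻¹⁻ʲ 2⁻¹⁻ᵏ`
in the entry `(j, k)`. -/
def IsAlmostOrthonormal (u : ℕ → H) : Prop :=
  ∀ j k, ‖⟪u j, u k⟫_ℂ - if j = k then 1 else 0‖ ≤ (1 / 2 : ℝ) ^ (j + 1) * (1 / 2) ^ (k + 1)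

theorem sum_half_pow_sq_le (s : Finset ℕ) : ∑ j ∈ s, ((1 / 2 : ℝ) ^ (j + 1)) ^ 2 ≤ 1 / 3 := by
  have h : HasSum (fun j : ℕ => ((1 / 2 : ℝ) ^ (j + 1)) ^ 2) (1 / 3) := by
    have := (hasSum_geometric_of_lt_one (r := (1 / 4 : ℝ)) (by norm_num) (by norm_num)).mul_left
      (1 / 4)
    have e : (1 / 4 : ℝ) * (1 - 1 / 4)⁻¹ = 1 / 3 := by norm_num
    rw [e] at this
    refine this.congr_fun ?_
    intro j
    rw [← pow_mul, mul_comm (j + 1) 2, pow_mul]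
    norm_num [pow_succ]
    ring
  exact sum_le_hasSum s (fun j _ => by positivity) h

theorem sq_sum_mul_half_pow_le (s : Finset ℕ) (a : ℕ → ℂ) :
    (∑ j ∈ s, ‖a j‖ * (1 / 2 : ℝ) ^ (j + 1)) ^ 2 ≤ (∑ j ∈ s, ‖a j‖ ^ 2) * (1 / 3) :=
  (Finset.sum_mul_sq_le_sq_mul_sq s _ _).trans
    (mul_le_mul_of_nonneg_left (sum_half_pow_sq_le s) (Finset.sum_nonneg fun _ _ => by positivity))

theorem IsAlmostOrthonormal.norm_inner_sub_le {u : ℕ → H} (hu : IsAlmostOrthonormal u)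
    (s : Finset ℕ) (a b : ℕ → ℂ) :
    ‖⟪∑ j ∈ s, a j • u j, ∑ k ∈ s, b k • u k⟫_ℂ - ∑ j ∈ s, (starRingEnd ℂ) (a j) * b j‖ ≤
      (∑ j ∈ s, ‖a j‖ * (1 / 2 : ℝ) ^ (j + 1)) * ∑ k ∈ s, ‖b k‖ * (1 / 2 : ℝ) ^ (k + 1) := by
  have h : ⟪∑ j ∈ s, a j • u j, ∑ k ∈ s, b k • u k⟫_ℂ - ∑ j ∈ s, (starRingEnd ℂ) (a j) * b j =
      ∑ j ∈ s, ∑ k ∈ s, (starRingEnd ℂ) (a j) * b k * (⟪u j, u k⟫_ℂ - if j = k then 1 else 0) := by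
    rw [sum_inner, ← Finset.sum_sub_distrib]
    refine Finset.sum_congr rfl fun j hj => ?_
    rw [inner_sum]
    simp only [mul_sub, Finset.sum_sub_distrib, inner_smul_left, inner_smul_right]
    congr 1
    · exact Finset.sum_congr rfl fun k _ => by ring
    · simp [hj]
  rw [h, Finset.sum_mul_sum]
  refine (norm_sum_le _ _).trans (Finset.sum_le_sum fun j _ => ?_)
  refine (norm_sum_le _ _).trans (Finset.sum_le_sum fun k _ => ?_)
  rw [norm_mul, norm_mul, RCLike.norm_conj]
  calc _ ≤ ‖a j‖ * ‖b k‖ * ((1 / 2 : ℝ) ^ (j + 1) * (1 / 2) ^ (k + 1)) :=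
        mul_le_mul_of_nonneg_left (hu j k) (by positivity)
    _ = _ := by ring

/-- Since `∑ 4⁻¹⁻ʲ = 1/3`, Cauchy–Schwarz bounds the Gram error by a third of the sum of squares,
which leaves `2/3`. -/
theorem IsAlmostOrthonormal.sum_sq_le {u : ℕ → H} (hu : IsAlmostOrthonormal u)
    (s : Finset ℕ) (a : ℕ → ℂ) :
    2 / 3 * ∑ j ∈ s, ‖a j‖ ^ 2 ≤ ‖∑ j ∈ s, a j • u j‖ ^ 2 := by
  have h1 := (hu.norm_inner_sub_le s a a).trans_eq (sq _).symm
  have h2 := h1.trans (sq_sum_mul_half_pow_le s a)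
  have h3 : ∑ j ∈ s, (starRingEnd ℂ) (a j) * a j = ((∑ j ∈ s, ‖a j‖ ^ 2 : ℝ) : ℂ) := by
    push_cast
    exact Finset.sum_congr rfl fun j _ => RCLike.conj_mul _
  rw [h3, inner_self_eq_norm_sq_to_K] at h2
  have h4 : ‖((‖∑ j ∈ s, a j • u j‖ ^ 2 - ∑ j ∈ s, ‖a j‖ ^ 2 : ℝ) : ℂ)‖ ≤
      (∑ j ∈ s, ‖a j‖ ^ 2) * (1 / 3) := by
    push_cast
    push_cast at h2
    exact h2
  rw [Complex.norm_real, Real.norm_eq_abs] at h4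
  linarith [neg_abs_le (‖∑ j ∈ s, a j • u j‖ ^ 2 - ∑ j ∈ s, ‖a j‖ ^ 2)]

theorem IsAlmostOrthonormal.linearIndependent {u : ℕ → H} (hu : IsAlmostOrthonormal u) :
    LinearIndependent ℂ u := by
  rw [linearIndependent_iff']
  intro s a h j hj
  have h1 := hu.sum_sq_le s a
  rw [h, norm_zero] at h1
  have h2 : ∑ j ∈ s, ‖a j‖ ^ 2 = 0 :=
    le_antisymm (by linarith) (Finset.sum_nonneg fun _ _ => by positivity)
  simpa using (Finset.sum_eq_zero_iff_of_nonneg fun _ _ => by positivity).1 h2 j hj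

/-- The diagonal terms vanish, and the off-diagonal error `1/3` against the lower bound `2/3` gives
`1/2`. Any constant below `1` would keep the closed spans apart. -/
theorem IsAlmostOrthonormal.norm_inner_le {u : ℕ → H} (hu : IsAlmostOrthonormal u)
    {S T : Set ℕ} (hST : Disjoint S T) {x y : H} (hx : x ∈ Submodule.span ℂ (u '' S))
    (hy : y ∈ Submodule.span ℂ (u '' T)) : ‖⟪x, y⟫_ℂ‖ ≤ 1 / 2 * (‖x‖ * ‖y‖) := by
  rw [Finsupp.mem_span_image_iff_linearCombination] at hx hy
  obtain ⟨a, ha, rfl⟩ := hx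
  obtain ⟨b, hb, rfl⟩ := hy
  set s := a.support ∪ b.support
  have hsum : ∀ l : ℕ →₀ ℂ, l.support ⊆ s →
      Finsupp.linearCombination ℂ u l = ∑ j ∈ s, l j • u j := fun l hl => by
    rw [Finsupp.linearCombination_apply]
    exact Finsupp.sum_of_support_subset l hl _ (fun _ _ => zero_smul _ _)
  rw [hsum a Finset.subset_union_left, hsum b Finset.subset_union_right]
  have h0 : ∑ j ∈ s, (starRingEnd ℂ) (a j) * b j = 0 := by
    refine Finset.sum_eq_zero fun j _ => ?_
    by_cases haj : a j = 0
    · simp [haj]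
    · have hjS : j ∈ S := ha (Finsupp.mem_support_iff.2 haj)
      have : b j = 0 := by
        by_contra hbj
        exact Set.disjoint_left.1 hST hjS (hb (Finsupp.mem_support_iff.2 hbj))
      simp [this]
  have h1 := hu.norm_inner_sub_le s a b
  rw [h0, sub_zero] at h1
  have ha1 := sq_sum_mul_half_pow_le s a
  have hb1 := sq_sum_mul_half_pow_le s b
  have ha2 := hu.sum_sq_le s a
  have hb2 := hu.sum_sq_le s b
  refine h1.trans ?_
  refine abs_le_of_sq_le_sq' ?_ (by positivity) |>.2
  calc _ = (∑ j ∈ s, ‖a j‖ * (1 / 2 : ℝ) ^ (j + 1)) ^ 2 *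
        (∑ k ∈ s, ‖b k‖ * (1 / 2 : ℝ) ^ (k + 1)) ^ 2 := by ring
    _ ≤ (1 / 2 * ‖∑ j ∈ s, a j • u j‖ ^ 2) * (1 / 2 * ‖∑ j ∈ s, b j • u j‖ ^ 2) :=
        mul_le_mul (by linarith) (by linarith) (by positivity) (by positivity)
    _ = _ := by ring

theorem disjoint_topologicalClosure_of_norm_inner_le {X Y : Submodule ℂ H}
    (h : ∀ x ∈ X, ∀ y ∈ Y, ‖⟪x, y⟫_ℂ‖ ≤ 1 / 2 * (‖x‖ * ‖y‖)) :
    X.topologicalClosure ⊓ Y.topologicalClosure = ⊥ := by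
  rw [eq_bot_iff]
  rintro x ⟨hx, hy⟩
  have hcl : IsClosed {p : H × H | ‖⟪p.1, p.2⟫_ℂ‖ ≤ 1 / 2 * (‖p.1‖ * ‖p.2‖)} :=
    isClosed_le (by fun_prop) (by fun_prop)
  have hsub : closure ((X : Set H) ×ˢ (Y : Set H)) ⊆
      {p : H × H | ‖⟪p.1, p.2⟫_ℂ‖ ≤ 1 / 2 * (‖p.1‖ * ‖p.2‖)} :=
    closure_minimal (fun p hp => h _ hp.1 _ hp.2) hcl
  have hmem : (x, x) ∈ closure ((X : Set H) ×ˢ (Y : Set H)) := by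
    rw [closure_prod_eq]
    exact ⟨hx, hy⟩
  have := hsub hmem
  simp only [Set.mem_ofPred_eq, inner_self_eq_norm_sq_to_K] at this
  rw [norm_pow, RCLike.norm_ofReal, abs_norm] at this
  have hx0 : ‖x‖ ^ 2 ≤ 0 := by nlinarith
  simpa using hx0

/-- The even or the odd indices work. Otherwise both orthogonal complements are finite-dimensional,
while their sum has orthogonal complement `Y ⊓ Z = ⊥`; being closed, the sum would be all of `H`. -/
theorem IsAlmostOrthonormal.exists_isHalfSpace [CompleteSpace H] {u : ℕ → H}
    (hH : ¬ FiniteDimensional ℂ H) (hu : IsAlmostOrthonormal u) :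
    ∃ S : Set ℕ, IsHalfSpace (Submodule.span ℂ (u '' S)).topologicalClosure := by
  have hinf : ∀ (S : Set ℕ) (f : ℕ → ℕ), Function.Injective f → (∀ n, f n ∈ S) →
      ¬ FiniteDimensional ℂ (Submodule.span ℂ (u '' S)).topologicalClosure := fun S f hf hfS =>
    not_finiteDimensional_of_linearIndependent (hu.linearIndependent.comp f hf) fun n =>
      Submodule.le_topologicalClosure _ (Submodule.subset_span ⟨f n, hfS n, rfl⟩)
  by_contra! hno
  have hfin : ∀ (S : Set ℕ) (f : ℕ → ℕ), Function.Injective f → (∀ n, f n ∈ S) →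
      FiniteDimensional ℂ (Submodule.span ℂ (u '' S)).topologicalClosureᗮ := fun S f hf hfS => by
    by_contra hnot
    exact hno S ⟨Submodule.isClosed_topologicalClosure _, hinf S f hf hfS, hnot⟩
  have h1 := hfin {n | Even n} (fun n => 2 * n) (fun a b h => by simpa using h) (by simp)
  have h2 := hfin {n | Odd n} (fun n => 2 * n + 1) (fun a b h => by simpa using h) (by simp)
  have hd : Disjoint {n : ℕ | Even n} {n | Odd n} :=
    Set.disjoint_left.2 fun n hn hn' => (Nat.not_even_iff_odd.2 hn') hn
  have hbot := disjoint_topologicalClosure_of_norm_inner_le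
    (X := Submodule.span ℂ (u '' {n | Even n})) (Y := Submodule.span ℂ (u '' {n | Odd n}))
    fun x hx y hy => hu.norm_inner_le hd hx hy
  set Y := (Submodule.span ℂ (u '' {n | Even n})).topologicalClosure
  set Z := (Submodule.span ℂ (u '' {n | Odd n})).topologicalClosure
  have hsup : (Yᗮ ⊔ Zᗮ)ᗮ = ⊥ := by
    have hY := (Submodule.isClosed_topologicalClosure
      (Submodule.span ℂ (u '' {n | Even n}))).completeSpace_coe
    have hZ := (Submodule.isClosed_topologicalClosure
      (Submodule.span ℂ (u '' {n | Odd n}))).completeSpace_coe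
    rw [← Submodule.inf_orthogonal, Submodule.orthogonal_orthogonal Y,
      Submodule.orthogonal_orthogonal Z, hbot]
  rw [Submodule.orthogonal_eq_bot_iff] at hsup
  have : FiniteDimensional ℂ (Yᗮ ⊔ Zᗮ : Submodule ℂ H) := Submodule.finiteDimensional_sup _ _
  rw [hsup] at this
  exact hH (Module.finite_def.2 (Module.Finite.iff_fg.1 this))

theorem exists_isAlmostOrthonormal_comp {u : ℕ → H} (hu : ∀ n, ‖u n‖ = 1)
    (hw : ∀ y, Tendsto (fun n => ⟪y, u n⟫_ℂ) atTop (𝓝 0)) :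
    ∃ φ : ℕ → ℕ, IsAlmostOrthonormal (u ∘ φ) := by
  -- The recursion does not see its own index, so each choice carries an exponent along with its
  -- position in `u`. Exponents increase strictly, hence dominate the index.
  obtain ⟨f, -, hf⟩ := exists_seq_of_forall_finset_exists (fun _ : ℕ × ℕ => True)
    (fun p q => p.1 < q.1 ∧
      ‖⟪u p.2, u q.2⟫_ℂ‖ ≤ (1 / 2 : ℝ) ^ (p.1 + 1) * (1 / 2) ^ (q.1 + 1)) (by
    intro s _
    have hk : ∀ p ∈ s, p.1 < s.sup Prod.fst + 1 := fun p hp =>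
      Nat.lt_succ_of_le (Finset.le_sup (f := Prod.fst) hp)
    have hn : ∀ᶠ n in atTop, ∀ p ∈ s, ‖⟪u p.2, u n⟫_ℂ‖ ≤
        (1 / 2 : ℝ) ^ (p.1 + 1) * (1 / 2) ^ (s.sup Prod.fst + 1 + 1) := by
      rw [Filter.eventually_all_finset]
      intro p _
      have := (hw (u p.2)).norm
      rw [norm_zero] at this
      exact this.eventually_le_const (by positivity)
    obtain ⟨n, hn⟩ := hn.exists
    exact ⟨(s.sup Prod.fst + 1, n), trivial, fun p hp => ⟨hk p hp, hn p hp⟩⟩)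
  have hmono : StrictMono fun n => (f n).1 := fun m n hmn => (hf m n hmn).1
  have hlt : ∀ j k, j < k →
      ‖⟪u (f j).2, u (f k).2⟫_ℂ‖ ≤ (1 / 2 : ℝ) ^ (j + 1) * (1 / 2) ^ (k + 1) := by
    intro j k hjk
    refine (hf j k hjk).2.trans (mul_le_mul ?_ ?_ (by positivity) (by positivity)) <;>
    · refine pow_le_pow_of_le_one (by norm_num) (by norm_num) ?_
      have := hmono.le_apply (x := j)
      have := hmono.le_apply (x := k)
      omega
  refine ⟨fun n => (f n).2, fun j k => ?_⟩
  simp only [Function.comp_apply]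
  rcases lt_trichotomy j k with h | rfl | h
  · simpa [h.ne] using hlt j k h
  · simp [inner_self_eq_norm_sq_to_K, hu]
  · rw [if_neg h.ne', sub_zero, ← inner_conj_symm, RCLike.norm_conj, mul_comm]
    exact hlt k j h

/-- Injectivity of `D` makes the range of its adjoint dense, and vectors of that range test `u`
through `D (u n)`. -/
theorem tendsto_inner_of_tendsto_apply [CompleteSpace H] {D : H →L[ℂ] H}
    (hD : Function.Injective D) {u : ℕ → H} (hu : ∀ n, ‖u n‖ = 1)
    (h : Tendsto (fun n => D (u n)) atTop (𝓝 0)) (y : H) :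
    Tendsto (fun n => ⟪y, u n⟫_ℂ) atTop (𝓝 0) := by
  have hdense : (ContinuousLinearMap.adjoint D).range.topologicalClosure = ⊤ := by
    rw [Submodule.topologicalClosure_eq_top_iff, ContinuousLinearMap.orthogonal_range,
      ContinuousLinearMap.adjoint_adjoint]
    exact LinearMap.ker_eq_bot.2 hD
  have hy : y ∈ closure ((ContinuousLinearMap.adjoint D).range : Set H) := by
    have : y ∈ (ContinuousLinearMap.adjoint D).range.topologicalClosure := hdense ▸ trivial
    exact this
  rw [Metric.tendsto_atTop]
  intro ε hε
  obtain ⟨_, ⟨v, rfl⟩, hv⟩ := Metric.mem_closure_iff.1 hy (ε / 2) (half_pos hε)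
  have h1 : Tendsto (fun n => ⟪v, D (u n)⟫_ℂ) atTop (𝓝 0) := by
    simpa using (tendsto_const_nhds (x := v)).inner h
  obtain ⟨N, hN⟩ := Metric.tendsto_atTop.1 h1 (ε / 2) (half_pos hε)
  refine ⟨N, fun n hn => ?_⟩
  have h2 := hN n hn
  rw [dist_zero_right] at h2 ⊢
  have h3 : ⟪y, u n⟫_ℂ = ⟪y - ContinuousLinearMap.adjoint D v, u n⟫_ℂ + ⟪v, D (u n)⟫_ℂ := by
    rw [inner_sub_left, ContinuousLinearMap.adjoint_inner_left]
    ring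
  have h4 : ‖⟪y - ContinuousLinearMap.adjoint D v, u n⟫_ℂ‖ < ε / 2 := by
    refine (norm_inner_le_norm _ _).trans_lt ?_
    rw [hu, mul_one, ← dist_eq_norm]
    exact hv
  rw [h3]
  linarith [norm_add_le ⟪y - ContinuousLinearMap.adjoint D v, u n⟫_ℂ ⟪v, D (u n)⟫_ℂ]

theorem HasAlmostInvariantHalfSpace.of_weakly_null [CompleteSpace H]
    (hH : ¬ FiniteDimensional ℂ H) {T : H →L[ℂ] H} {u : ℕ → H} {ν c : ℕ → ℂ} {e : H}
    (hu : ∀ n, ‖u n‖ = 1) (hw : ∀ y, Tendsto (fun n => ⟪y, u n⟫_ℂ) atTop (𝓝 0))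
    (hT : ∀ n, T (u n) = ν n • u n + c n • e) : HasAlmostInvariantHalfSpace T := by
  obtain ⟨φ, hφ⟩ := exists_isAlmostOrthonormal_comp hu hw
  obtain ⟨S, hS⟩ := hφ.exists_isHalfSpace hH
  refine ⟨_, e, hS, IsInvariantModulo.topologicalClosure_span ?_⟩
  rintro _ ⟨n, hn, rfl⟩
  refine ⟨c (φ n), ?_⟩
  rw [Function.comp_apply, hT, add_sub_cancel_right]
  exact Submodule.smul_mem _ _ (Submodule.subset_span ⟨n, hn, rfl⟩)

/-- By uniform boundedness, pointwise bounded resolvents would be norm bounded, and a small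
perturbation would then make `μ - T` invertible. -/
theorem exists_tendsto_resolvent_atTop [CompleteSpace H] {T : H →L[ℂ] H} {μ : ℂ}
    (hμ : μ ∈ frontier (spectrum ℂ T)) :
    ∃ (e : H) (ν : ℕ → ℂ) (w : ℕ → H), Tendsto ν atTop (𝓝 μ) ∧
      (∀ n, T (w n) = ν n • w n - e) ∧ ∀ n : ℕ, (n : ℝ) < ‖w n‖ := by
  have hmem : μ ∈ spectrum ℂ T := (spectrum.isClosed T).frontier_subset hμ
  have hcl : μ ∈ closure (spectrum ℂ T)ᶜ := by
    rw [frontier_eq_closure_inter_closure] at hμ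
    exact hμ.2
  obtain ⟨ν, hν, hlim⟩ := mem_closure_iff_seq_limit.1 hcl
  choose U hU using fun n => spectrum.notMem_iff.1 (hν n)
  have hnt : Nontrivial (H →L[ℂ] H) := by
    by_contra hnt
    rw [not_nontrivial_iff_subsingleton] at hnt
    exact hmem (isUnit_of_subsingleton _)
  have hunb : ∃ e : H, ∀ C, ∃ n, C < ‖(↑(U n)⁻¹ : H →L[ℂ] H) e‖ := by
    by_contra! hb
    obtain ⟨C, hC⟩ := banach_steinhaus hb
    have hC0 : 0 < C := (Units.norm_pos (U 0)⁻¹).trans_le (hC 0)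
    obtain ⟨n, hn⟩ := ((Metric.tendsto_atTop.1 hlim) C⁻¹ (inv_pos.2 hC0))
    have hn := hn n le_rfl
    apply hmem
    have hlt : ‖(algebraMap ℂ (H →L[ℂ] H) μ - T) - U n‖ < ‖(↑(U n)⁻¹ : H →L[ℂ] H)‖⁻¹ := by
      rw [hU, sub_sub_sub_cancel_right, ← map_sub, norm_algebraMap', ← dist_eq_norm, dist_comm]
      exact hn.trans_le (inv_anti₀ (Units.norm_pos _) (hC n))
    exact ⟨Units.ofNearby (U n) _ hlt, rfl⟩
  obtain ⟨e, he⟩ := hunb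
  -- The condition `k ≤ n` preserves convergence to `μ` along the selected indices.
  have hfreq : ∀ k : ℕ, ∃ n, k ≤ n ∧ (k : ℝ) < ‖(↑(U n)⁻¹ : H →L[ℂ] H) e‖ := by
    intro k
    by_contra! hb
    have : IsBoundedUnder (· ≤ ·) atTop fun n => ‖(↑(U n)⁻¹ : H →L[ℂ] H) e‖ :=
      ⟨k, eventually_map.2 (eventually_atTop.2 ⟨k, hb⟩)⟩
    obtain ⟨C, hC⟩ := this.bddAbove_range
    obtain ⟨n, hn⟩ := he C
    exact hn.not_ge (hC ⟨n, rfl⟩)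
  choose φ hφ hlt using hfreq
  refine ⟨e, ν ∘ φ, fun k => (↑(U (φ k))⁻¹ : H →L[ℂ] H) e,
    hlim.comp (tendsto_atTop_mono hφ tendsto_id), fun k => ?_, hlt⟩
  have h1 : ((U (φ k) : H →L[ℂ] H) * ↑(U (φ k))⁻¹) e = e := by
    rw [Units.mul_inv, one_apply_eq_self]
  rw [mul_apply_eq_comp, hU, sub_apply,
    ContinuousLinearMap.algebraMap_apply] at h1
  nth_rw 3 [← h1]
  simp

theorem HasAlmostInvariantHalfSpace.of_mem_frontier_spectrum [CompleteSpace H]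
    (hH : ¬ FiniteDimensional ℂ H) {T : H →L[ℂ] H} {μ : ℂ}
    (hμ : μ ∈ frontier (spectrum ℂ T)) (hinj : ∀ x, T x = μ • x → x = 0) :
    HasAlmostInvariantHalfSpace T := by
  obtain ⟨e, ν, w, hν, hT, hw⟩ := exists_tendsto_resolvent_atTop hμ
  have hpos : ∀ n, 0 < ‖w n‖ := fun n => (Nat.cast_nonneg n).trans_lt (hw n)
  have hu : ∀ n, ‖(‖w n‖ : ℂ)⁻¹ • w n‖ = 1 := fun n => by
    rw [norm_smul, norm_inv, Complex.norm_real, norm_norm, inv_mul_cancel₀ (hpos n).ne']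
  have hTu : ∀ n, T ((‖w n‖ : ℂ)⁻¹ • w n) =
      ν n • ((‖w n‖ : ℂ)⁻¹ • w n) + (-(‖w n‖ : ℂ)⁻¹) • e := fun n => by
    rw [map_smul, hT]
    module
  refine .of_weakly_null hH hu ?_ hTu
  refine tendsto_inner_of_tendsto_apply (D := T - μ • (1 : H →L[ℂ] H)) ?_ hu ?_
  · rw [injective_iff_map_eq_zero]
    intro x hx
    apply hinj x
    simpa [sub_eq_zero] using hx
  · have hinv : Tendsto (fun n : ℕ => ‖w n‖⁻¹) atTop (𝓝 0) :=
      tendsto_inv_atTop_zero.comp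
        (tendsto_atTop_mono (fun n => (hw n).le) tendsto_natCast_atTop_atTop)
    have hbound : Tendsto (fun n => dist (ν n) μ + ‖w n‖⁻¹ * ‖e‖) atTop (𝓝 0) := by
      simpa using (tendsto_iff_dist_tendsto_zero.1 hν).add (hinv.mul_const ‖e‖)
    refine squeeze_zero_norm (fun n => ?_) hbound
    have : (T - μ • (1 : H →L[ℂ] H)) ((‖w n‖ : ℂ)⁻¹ • w n) =
        (ν n - μ) • ((‖w n‖ : ℂ)⁻¹ • w n) + (-(‖w n‖ : ℂ)⁻¹) • e := by
      rw [sub_apply, hTu]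
      simp only [smul_apply, one_apply_eq_self]
      module
    rw [this]
    refine (norm_add_le _ _).trans (add_le_add ?_ ?_)
    · rw [norm_smul, hu, mul_one, dist_eq_norm]
    · rw [norm_smul, norm_neg, norm_inv, Complex.norm_real, norm_norm]

end AlmostOrthonormal

/-! ### Finiteness of the spectrum of a counterexample -/

section Spectrum

variable {H : Type*} [NormedAddCommGroup H] [InnerProductSpace ℂ H] [CompleteSpace H]

/-- The complement of a finite set in the plane is connected, so it cannot be split into the
interior of `s` and the nonempty open `sᶜ` unless that interior is empty. -/
theorem eq_frontier_of_finite_frontier {s : Set ℂ} (hs : IsCompact s)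
    (hf : (frontier s).Finite) : s = frontier s := by
  have hconn : IsPreconnected (frontier s)ᶜ :=
    (hf.countable.isConnected_compl_of_one_lt_rank (by simp)).isPreconnected
  refine Set.Subset.antisymm (fun x hx => ?_) hs.isClosed.frontier_subset
  by_contra hxf
  have hxi : x ∈ interior s := by
    by_contra hxi
    exact hxf ⟨subset_closure hx, hxi⟩
  obtain ⟨z, hz⟩ : ∃ z, z ∉ s := by
    by_contra! hall
    rw [Set.eq_univ_of_forall hall] at hs
    exact noncompact_univ ℂ hs
  obtain ⟨y, -, hy1, hy2⟩ := hconn (interior s) sᶜ isOpen_interior hs.isClosed.isOpen_compl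
    (fun y hy => by
      by_cases hys : y ∈ s
      · left
        by_contra hyi
        exact hy ⟨subset_closure hys, hyi⟩
      · exact Or.inr hys)
    ⟨x, hxf, hxi⟩ ⟨z, fun h => hz (hs.isClosed.frontier_subset h), hz⟩
  exact hy2 (interior_subset hy1)

theorem star_mem_frontier_spectrum_adjoint {T : H →L[ℂ] H} {μ : ℂ}
    (hμ : μ ∈ frontier (spectrum ℂ T)) :
    (starRingEnd ℂ) μ ∈ frontier (spectrum ℂ (ContinuousLinearMap.adjoint T)) := by
  have h1 : spectrum ℂ (ContinuousLinearMap.adjoint T) =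
      Complex.conjCLE.toHomeomorph ⁻¹' spectrum ℂ T := spectrum.map_star T
  rw [h1, ← Homeomorph.preimage_frontier]
  simpa using hμ

theorem exists_eigenvector_of_mem_frontier (hH : ¬ FiniteDimensional ℂ H) {T : H →L[ℂ] H}
    (hT : ¬ HasAlmostInvariantHalfSpace T) {μ : ℂ} (hμ : μ ∈ frontier (spectrum ℂ T)) :
    ∃ x, T x = μ • x ∧ x ≠ 0 := by
  by_contra! h
  exact hT (.of_mem_frontier_spectrum hH hμ h)

theorem not_hasAlmostInvariantHalfSpace_adjoint {T : H →L[ℂ] H}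
    (hT : ¬ HasAlmostInvariantHalfSpace T) :
    ¬ HasAlmostInvariantHalfSpace (ContinuousLinearMap.adjoint T) := fun h =>
  hT (by simpa using h.adjoint)

theorem finite_frontier_spectrum (hH : ¬ FiniteDimensional ℂ H) {T : H →L[ℂ] H}
    (hT : ¬ HasAlmostInvariantHalfSpace T) : (frontier (spectrum ℂ T)).Finite := by
  by_contra hinf
  have : Infinite (frontier (spectrum ℂ T)) := Set.infinite_coe_iff.2 hinf
  let ν := Infinite.natEmbedding (frontier (spectrum ℂ T))
  have hν : Function.Injective fun n => (ν n : ℂ) := Subtype.val_injective.comp ν.injective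
  choose x hx hx0 using fun n => exists_eigenvector_of_mem_frontier hH hT (ν n).2
  choose y hy hy0 using fun n => exists_eigenvector_of_mem_frontier hH
    (not_hasAlmostInvariantHalfSpace_adjoint hT) (star_mem_frontier_spectrum_adjoint (ν n).2)
  have hxi : LinearIndependent ℂ x := Module.End.eigenvectors_linearIndependent'
    (T : H →ₗ[ℂ] H) (fun n => (ν n : ℂ)) hν x fun n =>
      ⟨Module.End.mem_eigenspace_iff.2 (hx n), hx0 n⟩
  have hyi : LinearIndependent ℂ y := Module.End.eigenvectors_linearIndependent'
    (ContinuousLinearMap.adjoint T : H →ₗ[ℂ] H) (fun n => (starRingEnd ℂ) (ν n))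
    ((starRingEnd ℂ).injective.comp hν) y fun n =>
      ⟨Module.End.mem_eigenspace_iff.2 (hy n), hy0 n⟩
  have horth : ∀ m n, m ≠ n → ⟪x m, y n⟫_ℂ = 0 := fun m n hmn => by
    have h := ContinuousLinearMap.adjoint_inner_right T (x m) (y n)
    rw [hx, hy, inner_smul_left, inner_smul_right, ← sub_eq_zero, ← sub_mul, ← map_sub] at h
    refine (mul_eq_zero.1 h).resolve_left fun h0 => hmn ?_
    exact (hν (sub_eq_zero.1 ((map_eq_zero _).1 h0))).symm
  apply hT
  -- Even-indexed eigenvectors of `T` span the half-space; odd-indexed eigenvectors of the adjoint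
  -- witness its infinite codimension.
  refine ⟨_, 0, IsHalfSpace.of_orthogonal_sequences
    (hxi.comp (fun n : ℕ => 2 * n) fun a b h => by simpa using h)
    (hyi.comp (fun n : ℕ => 2 * n + 1) fun a b h => by simpa using h)
    fun m n => horth _ _ (show 2 * m ≠ 2 * n + 1 by omega), IsInvariantModulo.topologicalClosure_span ?_⟩
  rintro _ ⟨n, rfl⟩
  refine ⟨0, ?_⟩
  rw [smul_zero, sub_zero, Function.comp_apply, hx]
  exact Submodule.smul_mem _ _ (Submodule.subset_span ⟨n, rfl⟩)

theorem spectrum_eq_frontier (hH : ¬ FiniteDimensional ℂ H) {T : H →L[ℂ] H}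
    (hT : ¬ HasAlmostInvariantHalfSpace T) : spectrum ℂ T = frontier (spectrum ℂ T) :=
  eq_frontier_of_finite_frontier (spectrum.isCompact T) (finite_frontier_spectrum hH hT)

theorem nontrivial_of_not_finiteDimensional {V : Type*} [AddCommGroup V] [Module ℂ V]
    (hV : ¬ FiniteDimensional ℂ V) : Nontrivial V := by
  by_contra h
  rw [not_nontrivial_iff_subsingleton] at h
  exact hV inferInstance

/-- The adjoint of an operator without almost invariant half-spaces has an eigenvector. -/
theorem exists_orthogonal_range_sub (hH : ¬ FiniteDimensional ℂ H) {T : H →L[ℂ] H}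
    (hT : ¬ HasAlmostInvariantHalfSpace T) :
    ∃ (μ : ℂ) (w : H), w ≠ 0 ∧ ∀ x, ⟪T x - μ • x, w⟫_ℂ = 0 := by
  have := nontrivial_of_not_finiteDimensional hH
  obtain ⟨μ, hμ⟩ := spectrum.nonempty T
  rw [spectrum_eq_frontier hH hT] at hμ
  obtain ⟨w, hw, hw0⟩ := exists_eigenvector_of_mem_frontier hH
    (not_hasAlmostInvariantHalfSpace_adjoint hT) (star_mem_frontier_spectrum_adjoint hμ)
  refine ⟨μ, w, hw0, fun x => ?_⟩
  rw [inner_sub_left, ← ContinuousLinearMap.adjoint_inner_right, hw, inner_smul_left,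
    inner_smul_right, sub_self]

theorem finite_hasEigenvalue (hH : ¬ FiniteDimensional ℂ H) {T : H →L[ℂ] H}
    (hT : ¬ HasAlmostInvariantHalfSpace T) :
    {μ : ℂ | Module.End.HasEigenvalue (T : H →ₗ[ℂ] H) μ}.Finite := by
  have hfin := finite_frontier_spectrum hH hT
  rw [← spectrum_eq_frontier hH hT] at hfin
  refine hfin.subset fun μ hμ => ?_
  obtain ⟨x, hx, hx0⟩ := Module.End.HasEigenvalue.exists_hasEigenvector hμ
  rw [Module.End.mem_eigenspace_iff] at hx
  intro hu
  have := (ContinuousLinearMap.isUnit_iff_bijective.1 hu).1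
  apply hx0
  apply (injective_iff_map_eq_zero _).1 this
  rw [sub_apply, sub_eq_zero]
  simpa using hx.symm

end Spectrum

/-! ### Locally nilpotent maps and generalised eigenspaces -/

section Algebra

variable {V : Type*} [AddCommGroup V] [Module ℂ V]

theorem fg_of_fg_map_pow {N : Module.End ℂ V} (hker : FiniteDimensional ℂ (LinearMap.ker N))
    {U : Submodule ℂ V} (n : ℕ) (h : (U.map (N ^ n)).FG) : U.FG := by
  induction n with
  | zero => simpa [Module.End.one_eq_id] using h
  | succ n ih =>
    apply ih
    apply Submodule.fg_of_fg_map_of_fg_inf_ker N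
    · rwa [← Submodule.map_comp, ← Module.End.mul_eq_comp, ← pow_succ']
    · exact Module.Finite.iff_fg.1 (Submodule.finiteDimensional_of_le
        (inf_le_right : _ ⊓ LinearMap.ker N ≤ LinearMap.ker N))

/-- If `N` is locally nilpotent on `U` and has finite-dimensional kernel, the images of `U` under
the powers of `N` stabilise. -/
theorem exists_map_pow_le {N : Module.End ℂ V} (hker : FiniteDimensional ℂ (LinearMap.ker N))
    {U : Submodule ℂ V} (hinv : ∀ x ∈ U, N x ∈ U) (hnil : ∀ x ∈ U, ∃ k, (N ^ k) x = 0) :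
    ∃ n, U.map (N ^ n) ≤ (U.map (N ^ n)).map N := by
  have hpow : ∀ k, ∀ x ∈ U, (N ^ k) x ∈ U := fun k => by
    induction k with
    | zero => simp
    | succ k ih =>
      intro x hx
      rw [pow_succ', Module.End.mul_apply]
      exact hinv _ (ih x hx)
  have hanti : Antitone fun n => (U.map (N ^ n)).comap (LinearMap.ker N).subtype := by
    refine antitone_nat_of_succ_le fun n => Submodule.comap_mono ?_
    rintro _ ⟨x, hx, rfl⟩
    exact ⟨N x, hinv x hx, by rw [pow_succ, Module.End.mul_apply]⟩
  obtain ⟨n, hn⟩ := IsArtinian.monotone_stabilizes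
    (⟨fun n => OrderDual.toDual ((U.map (N ^ n)).comap (LinearMap.ker N).subtype),
      fun a b h => hanti h⟩ : ℕ →o (Submodule ℂ (LinearMap.ker N))ᵒᵈ)
  have hstab : ∀ m, n ≤ m → ∀ x, N x = 0 → x ∈ U.map (N ^ n) → x ∈ U.map (N ^ m) := by
    intro m hm x hx hxn
    have h : (U.map (N ^ n)).comap (LinearMap.ker N).subtype =
      (U.map (N ^ m)).comap (LinearMap.ker N).subtype := hn m hm
    have h2 : (⟨x, hx⟩ : LinearMap.ker N) ∈ (U.map (N ^ n)).comap (LinearMap.ker N).subtype := hxn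
    rw [h] at h2
    exact h2
  -- Induction on the nilpotency order: `(N ^ j) x` lies in the kernel, where the images have
  -- stabilised, so it equals `(N ^ (j + (n + 1))) z`, and subtracting `(N ^ (n + 1)) z` from `x`
  -- lowers the order.
  have main : ∀ j, ∀ x ∈ U.map (N ^ n), (N ^ j) x = 0 → x ∈ U.map (N ^ (n + 1)) := by
    intro j
    induction j with
    | zero =>
      intro x _ hx
      rw [pow_zero, Module.End.one_apply] at hx
      rw [hx]
      exact Submodule.zero_mem _
    | succ j ih =>
      rintro _ ⟨x, hx, rfl⟩ hjx
      have h1 : N ((N ^ j) ((N ^ n) x)) = 0 := by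
        rwa [pow_succ', Module.End.mul_apply] at hjx
      have h2 : (N ^ j) ((N ^ n) x) ∈ U.map (N ^ n) :=
        ⟨(N ^ j) x, hpow j x hx, by
          rw [← Module.End.mul_apply, ← Module.End.mul_apply, pow_mul_comm]⟩
      obtain ⟨z, hz, hzx⟩ := hstab (j + (n + 1)) (by omega) _ h1 h2
      have h3 : (N ^ n) x - (N ^ (n + 1)) z ∈ U.map (N ^ (n + 1)) := by
        apply ih
        · refine Submodule.sub_mem _ ⟨x, hx, rfl⟩ ⟨N z, hinv z hz, ?_⟩
          rw [pow_succ, Module.End.mul_apply]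
        · rw [map_sub, ← hzx, pow_add, Module.End.mul_apply, sub_self]
      have h4 := Submodule.add_mem _ h3 (⟨z, hz, rfl⟩ : (N ^ (n + 1)) z ∈ U.map (N ^ (n + 1)))
      rwa [sub_add_cancel] at h4
  refine ⟨n, fun x hx => ?_⟩
  obtain ⟨y, hy, rfl⟩ := hx
  obtain ⟨k, hk⟩ := hnil _ (hpow n y hy)
  obtain ⟨z, hz, hzx⟩ := main k _ ⟨y, hy, rfl⟩ hk
  refine ⟨(N ^ n) z, ⟨z, hz, rfl⟩, ?_⟩
  rw [← hzx, pow_succ', Module.End.mul_apply]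

theorem le_map_sub_of_locally_nilpotent {N : Module.End ℂ V} {U : Submodule ℂ V}
    (hinv : ∀ x ∈ U, N x ∈ U) (hnil : ∀ x ∈ U, ∃ k, (N ^ k) x = 0) {c : ℂ} (hc : c ≠ 0) :
    ∀ x ∈ U, ∃ y ∈ U, N y - c • y = x := by
  have main : ∀ k, ∀ x ∈ U, (N ^ k) x = 0 → ∃ y ∈ U, N y - c • y = x := by
    intro k
    induction k with
    | zero =>
      intro x _ hx
      rw [pow_zero, Module.End.one_apply] at hx
      exact ⟨0, U.zero_mem, by simp [hx]⟩
    | succ k ih =>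
      intro x hx hk
      obtain ⟨y, hy, hyx⟩ := ih (N x) (hinv x hx) (by
        rwa [pow_succ, Module.End.mul_apply] at hk)
      refine ⟨c⁻¹ • (y - x), U.smul_mem _ (U.sub_mem hy hx), ?_⟩
      rw [map_smul, map_sub, smul_comm c, ← smul_sub, inv_smul_eq_iff₀ hc, ← hyx]
      module
  intro x hx
  obtain ⟨k, hk⟩ := hnil x hx
  exact main k x hx hk

theorem le_iSup_maxGenEigenspace (f : Module.End ℂ V) {U : Submodule ℂ V}
    [FiniteDimensional ℂ U] (hinv : ∀ x ∈ U, f x ∈ U) : U ≤ ⨆ μ, f.maxGenEigenspace μ := by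
  have h := Module.End.iSup_maxGenEigenspace_eq_top (f.restrict hinv)
  have h2 : U = (⨆ μ, Module.End.maxGenEigenspace (f.restrict hinv) μ).map U.subtype := by
    rw [h, Submodule.map_top, Submodule.range_subtype]
  conv_lhs => rw [h2]
  rw [Submodule.map_iSup]
  refine iSup_mono fun μ => ?_
  rw [Submodule.map_le_iff_le_comap]
  exact (Module.End.genEigenspace_restrict f U ⊤ μ hinv).le

end Algebra

/-! ### Existence of an almost invariant half-space -/

section Existence

variable {H : Type*} [NormedAddCommGroup H] [InnerProductSpace ℂ H] [CompleteSpace H]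

/-- Otherwise the stable image `U` of the powers of `N` is infinite-dimensional, and `T - ν` maps
`U` onto itself for every `ν`. But on the closure of `U` some `T - ν` must have a range that is not
dense. -/
theorem finiteDimensional_maxGenEigenspace {T : H →L[ℂ] H}
    (hT : ¬ HasAlmostInvariantHalfSpace T) (μ : ℂ) :
    FiniteDimensional ℂ (Module.End.maxGenEigenspace (T : H →ₗ[ℂ] H) μ) := by
  by_contra hV
  set V := Module.End.maxGenEigenspace (T : H →ₗ[ℂ] H) μ
  set N : Module.End ℂ H := (T : H →ₗ[ℂ] H) - μ • 1
  have hN : ∀ x, N x = T x - μ • x := fun x => rfl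
  have hker : FiniteDimensional ℂ (LinearMap.ker N) := by
    by_contra hk
    apply hT
    apply HasAlmostInvariantHalfSpace.of_ker (μ := μ)
    rwa [Module.End.eigenspace_def]
  have hVmem : ∀ x, x ∈ V ↔ ∃ k, (N ^ k) x = 0 := fun x => Module.End.mem_maxGenEigenspace _ _ _
  have hVinv : ∀ x ∈ V, N x ∈ V := fun x hx => by
    obtain ⟨k, hk⟩ := (hVmem x).1 hx
    refine (hVmem _).2 ⟨k, ?_⟩
    rw [← Module.End.mul_apply, ← pow_succ, pow_succ', Module.End.mul_apply, hk, map_zero]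
  obtain ⟨n, hn⟩ := exists_map_pow_le hker hVinv fun x hx => (hVmem x).1 hx
  set U := V.map (N ^ n)
  have hU : ¬ FiniteDimensional ℂ U := fun h =>
    hV (Module.Finite.iff_fg.2 (fg_of_fg_map_pow hker n (Module.Finite.iff_fg.1 h)))
  have hUinv : ∀ x ∈ U, N x ∈ U := by
    rintro _ ⟨x, hx, rfl⟩
    refine ⟨N x, hVinv x hx, ?_⟩
    rw [← Module.End.mul_apply, ← Module.End.mul_apply, ← pow_succ, ← pow_succ']
  have hUV : ∀ x ∈ U, x ∈ V := by
    rintro _ ⟨x, hx, rfl⟩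
    obtain ⟨k, hk⟩ := (hVmem x).1 hx
    refine (hVmem _).2 ⟨k, ?_⟩
    rw [← Module.End.mul_apply, pow_mul_comm, Module.End.mul_apply, hk, map_zero]
  have hW : IsClosed (U.topologicalClosure : Set H) := U.isClosed_topologicalClosure
  have hWinv : ∀ x ∈ U.topologicalClosure, T x ∈ U.topologicalClosure := by
    have hle : U.topologicalClosure ≤ U.topologicalClosure.comap (T : H →ₗ[ℂ] H) := by
      refine U.topologicalClosure_minimal (fun x hx => U.le_topologicalClosure ?_)
        (hW.preimage T.continuous)
      have h1 := U.add_mem (hUinv x hx) (U.smul_mem μ hx)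
      rwa [hN, sub_add_cancel] at h1
    exact hle
  have := hW.completeSpace_coe
  obtain ⟨ν, w, hw0, hw⟩ := exists_orthogonal_range_sub
    (not_finiteDimensional_of_le hU U.le_topologicalClosure)
    (fun h => hT (.of_restrict hW hWinv h))
  have hsurj : ∀ x ∈ U, ∃ y ∈ U, T y - ν • y = x := by
    intro x hx
    by_cases hνμ : ν = μ
    · obtain ⟨y, hy, hyx⟩ := hn hx
      exact ⟨y, hy, by rw [hνμ]; exact hyx⟩
    · obtain ⟨y, hy, hyx⟩ := le_map_sub_of_locally_nilpotent hUinv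
        (fun x hx => (hVmem x).1 (hUV x hx)) (sub_ne_zero.2 hνμ) x hx
      refine ⟨y, hy, ?_⟩
      rw [← hyx, hN]
      module
  have hwU : (w : H) ∈ Uᗮ := by
    rw [Submodule.mem_orthogonal]
    intro x hx
    obtain ⟨y, hy, rfl⟩ := hsurj x hx
    exact hw ⟨y, U.le_topologicalClosure hy⟩
  rw [← Submodule.orthogonal_closure] at hwU
  apply hw0
  have h0 := Submodule.inner_right_of_mem_orthogonal w.2 hwU
  exact Subtype.ext (inner_self_eq_zero.1 h0)

/-- Every bounded operator on an infinite-dimensional Hilbert space has a half-space that is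
invariant up to one dimension. -/
theorem hasAlmostInvariantHalfSpace (hH : ¬ FiniteDimensional ℂ H) (T : H →L[ℂ] H) :
    HasAlmostInvariantHalfSpace T := by
  by_contra hT
  set f : Module.End ℂ H := (T : H →ₗ[ℂ] H)
  set V := ⨆ μ, f.maxGenEigenspace μ
  have hVfin : FiniteDimensional ℂ V := by
    have hfin : Finite {μ : ℂ | f.HasEigenvalue μ} := (finite_hasEigenvalue hH hT).to_subtype
    have hV : V ≤ ⨆ μ : {μ : ℂ | f.HasEigenvalue μ}, f.maxGenEigenspace μ := by
      refine iSup_le fun μ => ?_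
      by_cases hμ : f.HasEigenvalue μ
      · exact le_iSup (fun μ : {μ : ℂ | f.HasEigenvalue μ} => f.maxGenEigenspace μ) ⟨μ, hμ⟩
      · have : f.maxGenEigenspace μ = ⊥ := by
          by_contra hne
          exact hμ (Module.End.HasUnifEigenvalue.lt (k := ⊤) one_pos hne)
        rw [this]
        exact bot_le
    have := fun μ => finiteDimensional_maxGenEigenspace hT μ
    exact Submodule.finiteDimensional_of_le hV
  have hVinv : ∀ x ∈ V, T x ∈ V := by
    have : V ≤ V.comap f := iSup_le fun μ x hx =>
      le_iSup f.maxGenEigenspace μ (Module.End.mapsTo_maxGenEigenspace_of_comm rfl μ hx)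
    exact this
  have hWinv : ∀ x ∈ Vᗮ, ContinuousLinearMap.adjoint T x ∈ Vᗮ := fun x hx => by
    rw [Submodule.mem_orthogonal]
    intro v hv
    rw [ContinuousLinearMap.adjoint_inner_right]
    exact Submodule.inner_right_of_mem_orthogonal (hVinv v hv) hx
  have hWinf : ¬ FiniteDimensional ℂ Vᗮ := fun h => by
    have h1 : FiniteDimensional ℂ (V ⊔ Vᗮ : Submodule ℂ H) := Submodule.finiteDimensional_sup _ _
    rw [Submodule.sup_orthogonal_of_hasOrthogonalProjection] at h1
    exact hH (Module.finite_def.2 (Module.Finite.iff_fg.1 h1))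
  obtain ⟨ν, w, hw0, hw⟩ := exists_orthogonal_range_sub hWinf (fun h =>
    not_hasAlmostInvariantHalfSpace_adjoint hT (.of_restrict V.isClosed_orthogonal hWinv h))
  -- Thus `w` is an eigenvector of the compression of `T` to `Vᗮ`, which makes `V ⊔ span {w}`
  -- invariant under `T`.
  have hTw : T w - (starRingEnd ℂ) ν • (w : H) ∈ V := by
    apply (Submodule.orthogonal_orthogonal V).le
    rw [Submodule.mem_orthogonal]
    intro x hx
    have h1 : ⟪ContinuousLinearMap.adjoint T x - ν • x, (w : H)⟫_ℂ = 0 := hw ⟨x, hx⟩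
    rw [inner_sub_left, ContinuousLinearMap.adjoint_inner_left, inner_smul_left] at h1
    rw [inner_sub_right, inner_smul_right, h1]
  have hle : V ⊔ Submodule.span ℂ {(w : H)} ≤ V := by
    refine le_iSup_maxGenEigenspace f (U := V ⊔ Submodule.span ℂ {(w : H)}) fun x hx => ?_
    obtain ⟨v, hv, z, hz, rfl⟩ := Submodule.mem_sup.1 hx
    obtain ⟨c, rfl⟩ := Submodule.mem_span_singleton.1 hz
    have h1 : f (v + c • (w : H)) = (T v + c • (T w - (starRingEnd ℂ) ν • (w : H))) +
        (c * (starRingEnd ℂ) ν) • (w : H) := by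
      change T (v + c • (w : H)) = _
      rw [map_add, map_smul]
      module
    rw [h1]
    exact Submodule.add_mem_sup (V.add_mem (hVinv v hv) (V.smul_mem c hTw))
      (Submodule.smul_mem _ _ (Submodule.mem_span_singleton_self _))
  have hwV : (w : H) ∈ V := hle (Submodule.mem_sup_right (Submodule.mem_span_singleton_self _))
  apply hw0
  exact Subtype.ext (inner_self_eq_zero.1 (Submodule.inner_right_of_mem_orthogonal hwV w.2))

end Existence

/-! ### Half-spaces that are not invariant -/

section Noninvariant

variable {H : Type*} [NormedAddCommGroup H] [InnerProductSpace ℂ H]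

/-- `T` has a half-space that is invariant up to one dimension, but not invariant. -/
def HasStrictlyAlmostInvariantHalfSpace (T : H →L[ℂ] H) : Prop :=
  ∃ (Y : Submodule ℂ H) (e : H), IsHalfSpace Y ∧ IsInvariantModulo T Y e ∧ ∃ y ∈ Y, T y ∉ Y

/-- On the quotient by `Y` every nonzero vector is an eigenvector, so the induced map is scalar. -/
theorem exists_smul_sub_mem {T : H →L[ℂ] H} {Y : Submodule ℂ H}
    (hinv : ∀ y ∈ Y, T y ∈ Y) (h : ∀ x, ∃ c : ℂ, T x - c • x ∈ Y) :
    ∃ μ : ℂ, ∀ x, T x - μ • x ∈ Y := by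
  let f : (H ⧸ Y) →ₗ[ℂ] (H ⧸ Y) := Y.mapQ Y (T : H →ₗ[ℂ] H) hinv
  have hf : ∀ v, ¬ LinearIndependent ℂ ![v, f v] := by
    intro v hv
    obtain ⟨x, rfl⟩ := Y.mkQ_surjective v
    obtain ⟨c, hc⟩ := h x
    have h1 : f (Y.mkQ x) = c • Y.mkQ x := by
      rw [← map_smul]
      exact (Submodule.Quotient.eq Y).2 hc
    have h2 := LinearIndependent.pair_iff.1 hv c (-1) (by rw [h1]; module)
    exact one_ne_zero (neg_eq_zero.1 h2.2)
  obtain ⟨μ, hμ⟩ := LinearMap.exists_eq_smul_id_of_forall_notLinearIndependent hf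
  refine ⟨μ, fun x => (Submodule.Quotient.eq Y).1 ?_⟩
  exact LinearMap.congr_fun hμ (Y.mkQ x)

theorem IsHalfSpace.sup_span_singleton {Y : Submodule ℂ H} (hY : IsHalfSpace Y) (x : H) :
    IsHalfSpace (Y ⊔ Submodule.span ℂ {x}) where
  isClosed := Submodule.isClosed_sup_finiteDimensional _ _ hY.isClosed
  not_finiteDimensional := not_finiteDimensional_of_le hY.not_finiteDimensional le_sup_left
  not_finiteDimensional_orthogonal h := by
    apply hY.not_finiteDimensional_orthogonal
    rw [← Submodule.inf_orthogonal] at h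
    replace h := Module.Finite.iff_fg.1 h
    refine Module.Finite.iff_fg.2 (Submodule.fg_of_fg_map_of_fg_inf_ker
      (innerSL ℂ x : H →ₗ[ℂ] ℂ) (IsNoetherian.noetherian _) ?_)
    have hker : LinearMap.ker (innerSL ℂ x : H →ₗ[ℂ] ℂ) = (Submodule.span ℂ {x})ᗮ := by
      ext y
      exact (Submodule.mem_orthogonal_singleton_iff_inner_right (𝕜 := ℂ) (u := x) (v := y)).symm
    rwa [hker]

/-- Adjoining `x` to `Y` leaves `T x` as the only defect, and `T x` falls outside the enlarged
space. -/
theorem HasStrictlyAlmostInvariantHalfSpace.of_invariant {T : H →L[ℂ] H} {Y : Submodule ℂ H}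
    (hY : IsHalfSpace Y) (hinv : ∀ y ∈ Y, T y ∈ Y) {x : H} (hx : ∀ c : ℂ, T x - c • x ∉ Y) :
    HasStrictlyAlmostInvariantHalfSpace T := by
  refine ⟨_, T x, hY.sup_span_singleton x, fun y hy => ?_, x,
    Submodule.mem_sup_right (Submodule.mem_span_singleton_self x), fun h => ?_⟩
  · obtain ⟨z, hz, w, hw, rfl⟩ := Submodule.mem_sup.1 hy
    obtain ⟨c, rfl⟩ := Submodule.mem_span_singleton.1 hw
    refine ⟨c, Submodule.mem_sup_left ?_⟩
    simpa using hinv z hz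
  · obtain ⟨z, hz, w, hw, hzw⟩ := Submodule.mem_sup.1 h
    obtain ⟨c, rfl⟩ := Submodule.mem_span_singleton.1 hw
    apply hx c
    rwa [← hzw, add_sub_cancel_right]

theorem exists_scalar_modulo_of_invariant {T : H →L[ℂ] H}
    (hT : ¬ HasStrictlyAlmostInvariantHalfSpace T) {Y : Submodule ℂ H} (hY : IsHalfSpace Y)
    (hinv : ∀ y ∈ Y, T y ∈ Y) : ∃ μ : ℂ, ∀ x, T x - μ • x ∈ Y := by
  refine exists_smul_sub_mem hinv fun x => ?_
  by_contra! hx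
  exact hT (.of_invariant hY hinv hx)

variable [CompleteSpace H]

theorem HasStrictlyAlmostInvariantHalfSpace.adjoint {T : H →L[ℂ] H}
    (h : HasStrictlyAlmostInvariantHalfSpace T) :
    HasStrictlyAlmostInvariantHalfSpace (ContinuousLinearMap.adjoint T) := by
  obtain ⟨Y, e, hY, hT, y, hy, hTy⟩ := h
  obtain ⟨f, hf⟩ := hT.adjoint hY.isClosed
  refine ⟨Yᗮ, f, hY.orthogonal, hf, ?_⟩
  by_contra! hinv
  apply hTy
  have := hY.isClosed.completeSpace_coe
  rw [← Submodule.orthogonal_orthogonal Y, Submodule.mem_orthogonal]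
  intro z hz
  rw [← ContinuousLinearMap.adjoint_inner_left]
  exact Submodule.inner_left_of_mem_orthogonal hy (hinv z hz)

theorem hasStrictlyAlmostInvariantHalfSpace (hH : ¬ FiniteDimensional ℂ H) {T : H →L[ℂ] H}
    (hs : ∀ c : ℂ, T ≠ c • (1 : H →L[ℂ] H)) : HasStrictlyAlmostInvariantHalfSpace T := by
  by_contra hT
  obtain ⟨Y, e, hY, hYe⟩ := hasAlmostInvariantHalfSpace hH T
  have hYc := hY.isClosed.completeSpace_coe
  have hinv : ∀ y ∈ Y, T y ∈ Y := by
    by_contra! hy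
    exact hT ⟨Y, e, hY, hYe, hy⟩
  have hinv' : ∀ z ∈ Yᗮ, ContinuousLinearMap.adjoint T z ∈ Yᗮ := fun z hz => by
    rw [Submodule.mem_orthogonal]
    intro v hv
    rw [ContinuousLinearMap.adjoint_inner_right]
    exact Submodule.inner_right_of_mem_orthogonal (hinv v hv) hz
  obtain ⟨μ, hμ⟩ := exists_scalar_modulo_of_invariant
    (fun h => hT (by simpa using h.adjoint)) hY.orthogonal hinv'
  -- The adjoint is scalar modulo `Yᗮ`; dually, `T` is scalar on `Y`, so every half-space of `Y` is
  -- invariant under `T`.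
  have hscalar : ∀ y ∈ Y, T y = (starRingEnd ℂ) μ • y := fun y hy => by
    rw [← sub_eq_zero]
    refine ext_inner_right ℂ fun z => ?_
    have h1 := Submodule.inner_right_of_mem_orthogonal hy (hμ z)
    rw [inner_sub_right, ContinuousLinearMap.adjoint_inner_right, inner_smul_right] at h1
    rw [inner_sub_left, inner_smul_left, Complex.conj_conj, h1, inner_zero_left]
  obtain ⟨Z, hZ⟩ := exists_isHalfSpace hY.not_finiteDimensional
  have hZY : ∀ X : Submodule ℂ Y, X.map Y.subtype ≤ Y := fun X => Submodule.map_subtype_le Y X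
  have hexists : ∀ X : Submodule ℂ Y, IsHalfSpace X → ∃ ν : ℂ, ∀ x, T x - ν • x ∈ X.map Y.subtype :=
    fun X hX => exists_scalar_modulo_of_invariant hT (hX.map_subtype hY.isClosed) fun y hy => by
      rw [hscalar y (hZY X hy)]
      exact Submodule.smul_mem _ _ hy
  obtain ⟨ν, hν⟩ := hexists Z hZ
  obtain ⟨ν', hν'⟩ := hexists Zᗮ hZ.orthogonal
  obtain ⟨x, hx⟩ : ∃ x, x ∉ Y := by
    by_contra! hall
    apply hY.not_finiteDimensional_orthogonal
    rw [Submodule.eq_top_iff'.2 hall, Submodule.top_orthogonal_eq_bot]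
    infer_instance
  -- Both differences lie in `Y`, so distinct scalars would put `x` in `Y`. With equal scalars, `T -
  -- ν • 1` takes values in both `Z` and `Zᗮ`, hence vanishes.
  have hνν' : ν' = ν := by
    by_contra hne
    apply hx
    have h1 := Y.sub_mem (hZY Z (hν x)) (hZY Zᗮ (hν' x))
    have h2 : T x - ν • x - (T x - ν' • x) = (ν' - ν) • x := by module
    rw [h2] at h1
    exact (Y.smul_mem_iff (sub_ne_zero.2 hne)).1 h1
  apply hs ν
  ext y
  obtain ⟨a, ha, hay⟩ := hν y
  obtain ⟨b, hb, hby⟩ := hν' y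
  rw [hνν', ← hay] at hby
  have hab : b = a := Subtype.ext hby
  rw [hab] at hb
  have ha0 : a = 0 := inner_self_eq_zero.1 (Submodule.inner_right_of_mem_orthogonal ha hb)
  rw [ha0, map_zero] at hay
  simpa using (sub_eq_zero.1 hay.symm)

end Noninvariant

/-! ### Ranks of the corners -/

section Rank

variable {H : Type*} [NormedAddCommGroup H] [InnerProductSpace ℂ H]

theorem rank_le_one_of_forall_mem_span {V W : Type*} [AddCommGroup V] [Module ℂ V]
    [AddCommGroup W] [Module ℂ W] {f : V →ₗ[ℂ] W} {w : W}
    (h : ∀ v, ∃ c : ℂ, f v = c • w) : LinearMap.rank f ≤ 1 := by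
  refine (rank_submodule_le_one_iff' _).2 ⟨w, ?_⟩
  rintro _ ⟨v, rfl⟩
  obtain ⟨c, hc⟩ := h v
  rw [hc]
  exact Submodule.smul_mem _ _ (Submodule.mem_span_singleton_self w)

theorem rank_eq_one_of_le_one {V W : Type*} [AddCommGroup V] [Module ℂ V]
    [AddCommGroup W] [Module ℂ W] {f : V →ₗ[ℂ] W} (h : LinearMap.rank f ≤ 1) {v : V}
    (hv : f v ≠ 0) : LinearMap.rank f = 1 := by
  refine le_antisymm h (Cardinal.one_le_iff_ne_zero.2 fun h0 => hv ?_)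
  rw [LinearMap.rank, Submodule.rank_eq_zero, LinearMap.range_eq_bot] at h0
  rw [h0, LinearMap.zero_apply]

variable {T : H →L[ℂ] H} {Y : Submodule ℂ H} [Y.HasOrthogonalProjection]

theorem offDiagonalPart_apply (x : H) : offDiagonalPart T Y x =
    T (Y.starProjection x) - Y.starProjection (T (Y.starProjection x)) := rfl

theorem lowerLeftCorner_apply (y : Y) :
    lowerLeftCorner T Y y = Yᗮ.orthogonalProjectionOnto (T y) := rfl

theorem IsInvariantModulo.rank_offDiagonalPart_le_one {e : H} (h : IsInvariantModulo T Y e) :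
    LinearMap.rank (offDiagonalPart T Y : H →ₗ[ℂ] H) ≤ 1 := by
  refine rank_le_one_of_forall_mem_span (w := e - Y.starProjection e) fun x => ?_
  obtain ⟨c, hc⟩ := h _ (Y.starProjection_apply_mem x)
  refine ⟨c, ?_⟩
  have h1 := Submodule.starProjection_eq_self_iff.2 hc
  rw [map_sub, map_smul] at h1
  rw [ContinuousLinearMap.coe_coe, offDiagonalPart_apply, smul_sub, sub_eq_sub_iff_sub_eq_sub, h1]

theorem IsInvariantModulo.rank_lowerLeftCorner_le_one {e : H} (h : IsInvariantModulo T Y e) :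
    LinearMap.rank (lowerLeftCorner T Y : Y →ₗ[ℂ] Yᗮ) ≤ 1 := by
  refine rank_le_one_of_forall_mem_span (w := Yᗮ.orthogonalProjectionOnto e) fun y => ?_
  obtain ⟨c, hc⟩ := h y y.2
  refine ⟨c, ?_⟩
  rw [ContinuousLinearMap.coe_coe, lowerLeftCorner_apply, ← sub_eq_zero, ← map_smul, ← map_sub]
  exact Submodule.orthogonalProjectionOnto_eq_zero_iff.2 (Submodule.le_orthogonal_orthogonal Y hc)

theorem offDiagonalPart_apply_ne_zero {y : H} (hy : y ∈ Y) (hTy : T y ∉ Y) :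
    offDiagonalPart T Y y ≠ 0 := fun h => by
  rw [offDiagonalPart_apply, Submodule.starProjection_eq_self_iff.2 hy, sub_eq_zero] at h
  exact hTy (Submodule.starProjection_eq_self_iff.1 h.symm)

theorem lowerLeftCorner_apply_ne_zero {y : Y} (hTy : T y ∉ Y) :
    lowerLeftCorner T Y y ≠ 0 := fun h => by
  rw [lowerLeftCorner_apply, Submodule.orthogonalProjectionOnto_eq_zero_iff,
    Submodule.orthogonal_orthogonal] at h
  exact hTy h

end Rank

theorem corollary2p5 {H : Type*} [NormedAddCommGroup H] [InnerProductSpace ℂ H]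
    [CompleteSpace H] [TopologicalSpace.SeparableSpace H]
    (hH : ¬ FiniteDimensional ℂ H) (T : H →L[ℂ] H) :
    ∃ (Y : Submodule ℂ H) (_ : Y.HasOrthogonalProjection),
      IsClosed (Y : Set H) ∧
      ¬ FiniteDimensional ℂ Y ∧
      ¬ FiniteDimensional ℂ Yᗮ ∧
      LinearMap.rank (offDiagonalPart T Y : H →ₗ[ℂ] H) ≤ 1 ∧
      LinearMap.rank (lowerLeftCorner T Y : Y →ₗ[ℂ] Yᗮ) ≤ 1 ∧
      ((∀ c : ℂ, T ≠ c • (1 : H →L[ℂ] H)) →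
        LinearMap.rank (offDiagonalPart T Y : H →ₗ[ℂ] H) = 1 ∧
        LinearMap.rank (lowerLeftCorner T Y : Y →ₗ[ℂ] Yᗮ) = 1) := by
  by_cases hs : ∀ c : ℂ, T ≠ c • (1 : H →L[ℂ] H)
  · obtain ⟨Y, e, hY, hTY, y, hy, hTy⟩ := hasStrictlyAlmostInvariantHalfSpace hH hs
    have := hY.isClosed.completeSpace_coe
    exact ⟨Y, inferInstance, hY.isClosed, hY.not_finiteDimensional,
      hY.not_finiteDimensional_orthogonal, hTY.rank_offDiagonalPart_le_one,
      hTY.rank_lowerLeftCorner_le_one, fun _ =>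
        ⟨rank_eq_one_of_le_one hTY.rank_offDiagonalPart_le_one
          (offDiagonalPart_apply_ne_zero hy hTy),
        rank_eq_one_of_le_one hTY.rank_lowerLeftCorner_le_one
          (lowerLeftCorner_apply_ne_zero (y := ⟨y, hy⟩) hTy)⟩⟩
  · obtain ⟨Y, e, hY, hTY⟩ := hasAlmostInvariantHalfSpace hH T
    have := hY.isClosed.completeSpace_coe
    exact ⟨Y, inferInstance, hY.isClosed, hY.not_finiteDimensional,
      hY.not_finiteDimensional_orthogonal, hTY.rank_offDiagonalPart_le_one,
      hTY.rank_lowerLeftCorner_le_one, fun h => absurd h hs⟩
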